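/- Let $L>1$, $\nu_1,\dots,\nu_N\in\mathbb R^2$ and $\Psi_i(x)=x/L+\nu_i$ ($1\le i\le N$), where $\nu_i=0$ for some $i$. Let $K^{\langle 0\rangle}$ be the unique nonempty compact set with $K^{\langle 0\rangle}=\bigcup_i\Psi_i(K^{\langle 0\rangle})$. Let $V$ be the set of essential fixed points, that is, fixed points $x$ of some $\Psi_m$ for which there are another fixed point $y\ne x$ (of some $\Psi_{m'}$) and two different maps $\Psi_i\neq\Psi_j$ with $\Psi_i(x)=\Psi_j(y)$; let $k=\#V$. Assume that $K^{\langle 0\rangle}$ is a simple nested fractal: $k\ge 2$; there is a nonempty open set $U\subset\mathbb R^2$ with $\bigcup_i\Psi_i(U)\subseteq U$ and $\Psi_i(U)\cap\Psi_j(U)=\emptyset$ for $i\ne j$; $\Psi_i(K^{\langle 0\rangle})\cap\Psi_j(K^{\langle 0\rangle})=\Psi_i(V)\cap\Psi_j(V)$ for $i\neq j$; for all $i$ and all distinct $x,y\in V$ the reflection in the perpendicular bisector of $[x,y]$ maps $\Psi_i(V)$ onto some $\Psi_j(V)$; and the graph on $\bigcup_i\Psi_i(V)$ in which two points are joined if they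 lie in a common set $\Psi_i(K^{\langle 0\rangle})$ is connected. Assume moreover that $k\geq 3$ and that $k$ is even. For $M\in\mathbb Z$ put $K^{\langle M\rangle}=L^MK^{\langle 0\rangle}$, and put $K^{\langle\infty\rangle}=\bigcup_{M\ge 0}K^{\langle M\rangle}$. An $M$-complex is a set $\Delta=K^{\langle M\rangle}+\nu_\Delta\subset K^{\langle\infty\rangle}$ with $\nu_\Delta=\sum_{j=M+1}^{J}L^j\nu_{i_j}$ for some $J\ge M+1$ and some indices $i_j$; its vertex set is $V(\Delta)=L^MV+\nu_\Delta$, and its center is the barycenter of $V(\Delta)$. Let $V_0^{\langle 0\rangle}=V$, $V_0^{\langle m+1\rangle}=\bigcup_i\bigl(V_0^{\langle m\rangle}+L^{m+1}\nu_i\bigr)$ and $V_M^{\langle\infty\rangle}=L^M\bigcup_{m\ge 0}V_0^{\langle m\rangle}$. The fractal has the good labelling property (GLP) if for some $M\in\mathbb Z$ there is a map $\ell:V_M^{\langle\infty\rangle}\to\mathcal A$ into an alphabet $\mathcal A$ of $k$ labels such that $\ell$ restricted to $L^MV$ is a bijection onto $\mathcal A$ and, for every $M$-complex $\Delta=K^{\langle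 M\rangle}+\nu_\Delta$, there is a rotation $R$ about the barycenter of $L^MV$ by an angle $2\pi j/k$ with $1\le j\le k$, such that $\ell(v)=\ell(R(v-\nu_\Delta))$ for all $v\in V(\Delta)$. Two complexes are adjacent if they are different and intersect. Let $G$ be the graph whose vertices are the centers of the $0$-complexes contained in $K^{\langle 1\rangle}$, two centers being joined by an edge if they are the centers of adjacent $0$-complexes contained in $K^{\langle 1\rangle}$. Then the fractal has GLP if and only if every closed path in $G$ (a path made of vectors that connect centers of adjacent $0$-complexes in $K^{\langle 1\rangle}$; repetitions are allowed) has even length. Moreover, every closed path in $G$ has even length if and only if $G$ is bipartite. -/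

import Mathlib

noncomputable section

namespace NestedFractal

/-- A finite system of similitudes `Ψ i x = x / L + ν i` of the plane `ℝ² = ℂ`, with a common
scaling factor `L > 1`. -/
structure SimSystem where
  N : ℕ
  N_pos : 0 < N
  L : ℝ
  one_lt_L : 1 < L
  ν : Fin N → ℂ

/-- The symmetry `S_{x,y}` with respect to the line that bisects the segment `[x, y]`
perpendicularly. -/
def bisectorReflection (x y : ℂ) : ℂ → ℂ :=
  haveI : Nonempty (AffineSubspace.perpBisector x y) :=
    AffineSubspace.perpBisector_nonempty.to_subtype
  EuclideanGeometry.reflection (AffineSubspace.perpBisector x y)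

namespace SimSystem

variable (S : SimSystem)

/-- The similitude `Ψ i`. -/
def Ψ (i : Fin S.N) (x : ℂ) : ℂ := x / (S.L : ℂ) + S.ν i

/-- `A` is a nonempty compact set with `A = ⋃ i, Ψ i (A)`. -/
def IsAttractor (A : Set ℂ) : Prop :=
  A.Nonempty ∧ IsCompact A ∧ A = ⋃ i, S.Ψ i '' A

theorem L_pos : 0 < S.L := zero_lt_one.trans S.one_lt_L

theorem L_ne : (S.L : ℂ) ≠ 0 := by
  exact_mod_cast S.L_pos.ne'

theorem isAttractor_subset {A B : Set ℂ} (hA : S.IsAttractor A) (hB : S.IsAttractor B) :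
    A ⊆ B := by
  obtain ⟨hAn, hAc, hAe⟩ := hA
  obtain ⟨hBn, hBc, hBe⟩ := hB
  obtain ⟨a, ha, hmax⟩ := hAc.exists_isMaxOn hAn
    (Metric.continuous_infDist_pt B).continuousOn
  have hle : ∀ x ∈ A, Metric.infDist x B ≤ Metric.infDist a B := fun x hx => hmax hx
  have key : S.L * Metric.infDist a B ≤ Metric.infDist a B := by
    have ha' := ha
    rw [hAe] at ha'
    obtain ⟨i, a', ha'A, rfl⟩ := Set.mem_iUnion.1 ha'
    obtain ⟨b, hbB, hb⟩ := hBc.exists_infDist_eq_dist hBn a'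
    have hbm : S.Ψ i b ∈ B := by
      rw [hBe]
      exact Set.mem_iUnion.2 ⟨i, b, hbB, rfl⟩
    have h1 : Metric.infDist (S.Ψ i a') B ≤ dist (S.Ψ i a') (S.Ψ i b) :=
      Metric.infDist_le_dist_of_mem hbm
    have h2 : dist (S.Ψ i a') (S.Ψ i b) = dist a' b / S.L := by
      simp only [Ψ, dist_eq_norm, add_sub_add_right_eq_sub]
      rw [← sub_div, norm_div, Complex.norm_real, Real.norm_of_nonneg S.L_pos.le]
    have h3 := hle a' ha'A
    rw [h2, ← hb] at h1
    rw [le_div_iff₀ S.L_pos] at h1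
    linarith
  have h0 : Metric.infDist a B ≤ 0 := by
    have := S.one_lt_L
    have hn : 0 ≤ Metric.infDist a B := Metric.infDist_nonneg
    nlinarith
  intro x hx
  rw [hBc.isClosed.mem_iff_infDist_zero hBn]
  exact le_antisymm ((hle x hx).trans h0) Metric.infDist_nonneg

/-- The limit point with a given address. -/
def limitPoint (ω : ℕ → Fin S.N) : ℂ := ∑' n, S.ν (ω n) / (S.L : ℂ) ^ n

theorem exists_bound : ∃ C : ℝ, ∀ i, ‖S.ν i‖ ≤ C :=
  ⟨∑ i, ‖S.ν i‖, fun i =>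
    Finset.single_le_sum (f := fun i => ‖S.ν i‖) (fun _ _ => norm_nonneg _) (Finset.mem_univ i)⟩

theorem norm_term_le {C : ℝ} (hC : ∀ i, ‖S.ν i‖ ≤ C) (n : ℕ) (i : Fin S.N) :
    ‖S.ν i / (S.L : ℂ) ^ n‖ ≤ C * (S.L⁻¹) ^ n := by
  rw [norm_div, norm_pow, Complex.norm_real, Real.norm_of_nonneg S.L_pos.le, inv_pow,
    ← div_eq_mul_inv]
  exact div_le_div_of_nonneg_right (hC i) (pow_pos S.L_pos n).le

theorem summable_bound (C : ℝ) : Summable fun n : ℕ => C * (S.L⁻¹) ^ n :=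
  (summable_geometric_of_lt_one (inv_nonneg.2 S.L_pos.le)
    (inv_lt_one_of_one_lt₀ S.one_lt_L)).mul_left C

theorem continuous_limitPoint : Continuous S.limitPoint := by
  obtain ⟨C, hC⟩ := S.exists_bound
  refine continuous_tsum (u := fun n : ℕ => C * (S.L⁻¹) ^ n) (fun n => ?_) (S.summable_bound C)
    fun n ω => S.norm_term_le hC n (ω n)
  exact ((continuous_of_discreteTopology (f := S.ν)).comp (continuous_apply n)).div_const _

theorem limitPoint_eq (ω : ℕ → Fin S.N) :
    S.limitPoint ω = S.Ψ (ω 0) (S.limitPoint fun n => ω (n + 1)) := by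
  obtain ⟨C, hC⟩ := S.exists_bound
  have hs : Summable fun n => S.ν (ω n) / (S.L : ℂ) ^ n :=
    Summable.of_norm_bounded (S.summable_bound C) fun n => S.norm_term_le hC n (ω n)
  unfold limitPoint Ψ
  rw [hs.tsum_eq_zero_add, ← tsum_div_const]
  simp only [pow_zero, div_one, pow_succ, div_div]
  rw [add_comm]

theorem isAttractor_range : S.IsAttractor (Set.range S.limitPoint) := by
  have hne : Nonempty (Fin S.N) := ⟨⟨0, S.N_pos⟩⟩
  refine ⟨Set.range_nonempty _, isCompact_range S.continuous_limitPoint, ?_⟩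
  apply Set.Subset.antisymm
  · rintro _ ⟨ω, rfl⟩
    rw [S.limitPoint_eq ω]
    exact Set.mem_iUnion.2 ⟨ω 0, _, ⟨_, rfl⟩, rfl⟩
  · intro x hx
    obtain ⟨i, _, ⟨ω, rfl⟩, rfl⟩ := Set.mem_iUnion.1 hx
    exact ⟨fun n => Nat.casesOn n i ω, S.limitPoint_eq _⟩

theorem existsUnique_attractor : ∃! A : Set ℂ, S.IsAttractor A :=
  ⟨_, S.isAttractor_range, fun _ hB => Set.Subset.antisymm
    (S.isAttractor_subset hB S.isAttractor_range) (S.isAttractor_subset S.isAttractor_range hB)⟩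

/-- The fractal generated by the system: the unique nonempty compact set `K` with
`K = ⋃ i, Ψ i (K)`. -/
def fractal : Set ℂ := S.existsUnique_attractor.choose

theorem isAttractor_fractal : S.IsAttractor S.fractal :=
  S.existsUnique_attractor.choose_spec.1

/-- The set of fixed points of the similitudes. -/
def fixedPts : Set ℂ := {x | ∃ i, S.Ψ i x = x}

/-- The set of essential fixed points. -/
def essentialPts : Set ℂ :=
  {x | x ∈ S.fixedPts ∧ ∃ y ∈ S.fixedPts, y ≠ x ∧ ∃ i j, S.Ψ i ≠ S.Ψ j ∧ S.Ψ i x = S.Ψ j y}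

/-- The number of essential fixed points. -/
def k : ℕ := S.essentialPts.ncard

/-- The graph on `⋃ i, Ψ i (V)`, `V` the set of essential fixed points, in which two points are
joined when they lie in a common set `Ψ i (K)`. -/
def cellPointGraph : SimpleGraph (⋃ i, S.Ψ i '' S.essentialPts : Set ℂ) where
  Adj x y := x ≠ y ∧ ∃ i, (x : ℂ) ∈ S.Ψ i '' S.fractal ∧ (y : ℂ) ∈ S.Ψ i '' S.fractal
  symm := ⟨fun _ _ h => ⟨h.1.symm, h.2.imp fun _ hi => hi.symm⟩⟩
  loopless := ⟨fun _ h => h.1 rfl⟩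

/-- The fractal generated by the system is a simple nested fractal. -/
structure IsSimpleNestedFractal : Prop where
  two_le_k : 2 ≤ S.k
  open_set : ∃ U : Set ℂ, IsOpen U ∧ U.Nonempty ∧
    (∀ i j, i ≠ j → S.Ψ i '' U ∩ S.Ψ j '' U = ∅) ∧ (⋃ i, S.Ψ i '' U) ⊆ U
  nesting : ∀ i j, i ≠ j → S.Ψ i '' S.fractal ∩ S.Ψ j '' S.fractal =
    S.Ψ i '' S.essentialPts ∩ S.Ψ j '' S.essentialPts
  /-- Reflections in the perpendicular bisectors permute the cells. -/
  symmetry : ∀ i, ∀ x ∈ S.essentialPts, ∀ y ∈ S.essentialPts, x ≠ y → ∃ j,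
    bisectorReflection x y '' (S.Ψ i '' S.essentialPts) = S.Ψ j '' S.essentialPts
  connectivity : S.cellPointGraph.Connected

/-- The scaled fractal `K^⟨M⟩ = L ^ M K`. -/
def scaled (M : ℤ) : Set ℂ := (fun z => (S.L : ℂ) ^ M * z) '' S.fractal

/-- The unbounded fractal `K^⟨∞⟩ = ⋃_{M ≥ 0} K^⟨M⟩`. -/
def unbounded : Set ℂ := ⋃ M : ℕ, S.scaled M

/-- The set `K^⟨M⟩ + c`. -/
def cell (M : ℤ) (c : ℂ) : Set ℂ := (fun z => z + c) '' S.scaled M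

/-- The set of `c` such that `K^⟨M⟩ + c` is an `M`-complex: `K^⟨M⟩ + c` lies in `K^⟨∞⟩` and
`c = ∑_{j = M + 1}^{J} L ^ j ν_{i_j}` for some `J ≥ M + 1`. -/
def complexShifts (M : ℤ) : Set ℂ :=
  {c | (∃ J : ℤ, M + 1 ≤ J ∧ ∃ i : ℤ → Fin S.N,
      c = ∑ j ∈ Finset.Icc (M + 1) J, (S.L : ℂ) ^ j * S.ν (i j)) ∧
    S.cell M c ⊆ S.unbounded}

/-- The vertices of `K^⟨M⟩ + c`, namely `L ^ M V + c`; with `c = 0` these are the vertices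
`V_M^⟨M⟩` of `K^⟨M⟩`. -/
def cellVertices (M : ℤ) (c : ℂ) : Set ℂ :=
  (fun z => (S.L : ℂ) ^ M * z + c) '' S.essentialPts

/-- The barycenter of `K^⟨M⟩ + c`: the mean of its vertices. -/
def barycenter (M : ℤ) (c : ℂ) : ℂ :=
  (∑ᶠ v ∈ S.cellVertices M c, v) / ((S.cellVertices M c).ncard : ℂ)

/-- The vertices `V_0^⟨m⟩` of all `0`-complexes inside `K^⟨m⟩`, where
`K^⟨m + 1⟩ = ⋃ i, (K^⟨m⟩ + L ^ (m + 1) ν_i)`. -/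
def levelVertices : ℕ → Set ℂ
  | 0 => S.essentialPts
  | m + 1 => ⋃ i, (fun z => z + (S.L : ℂ) ^ (m + 1) * S.ν i) '' levelVertices m

/-- The vertices `V_M^⟨∞⟩ = L ^ M ⋃_{m ≥ 0} V_0^⟨m⟩` of all `M`-complexes. -/
def unboundedVertices (M : ℤ) : Set ℂ :=
  (fun z => (S.L : ℂ) ^ M * z) '' ⋃ m : ℕ, S.levelVertices m

/-- The rotation by the angle `2 π j / k` about the barycenter of `K^⟨M⟩`. -/
def rot (M : ℤ) (j : ℕ) (z : ℂ) : ℂ :=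
  S.barycenter M 0 +
    Complex.exp (2 * Real.pi * Complex.I * j / S.k) * (z - S.barycenter M 0)

/-- `ℓ` is a good labelling function of order `M`, with an alphabet of `k` labels. -/
structure IsGoodLabelling (M : ℤ) (ℓ : S.unboundedVertices M → Fin S.k) : Prop where
  bijOn : Set.BijOn ℓ {v | (v : ℂ) ∈ S.cellVertices M 0} Set.univ
  rotation : ∀ c ∈ S.complexShifts M, ∃ j ∈ Finset.Icc 1 S.k,
    ∀ v : S.unboundedVertices M, (v : ℂ) ∈ S.cellVertices M c →
      ∃ w : S.unboundedVertices M, (w : ℂ) = S.rot M j ((v : ℂ) - c) ∧ ℓ v = ℓ w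

/-- The good labelling property: a good labelling function of some order exists. -/
def HasGLP : Prop := ∃ M : ℤ, ∃ ℓ : S.unboundedVertices M → Fin S.k, S.IsGoodLabelling M ℓ

/-- The shifts `c` for which `K^⟨0⟩ + c` is a `0`-complex contained in `K^⟨1⟩`. -/
def innerShifts : Set ℂ := {c | c ∈ S.complexShifts 0 ∧ S.cell 0 c ⊆ S.scaled 1}

/-- The centers (barycenters) of the `0`-complexes contained in `K^⟨1⟩`. -/
def centers : Set ℂ := S.barycenter 0 '' S.innerShifts

/-- Two complexes are adjacent when they are different and intersect. -/
def Adjacent (A B : Set ℂ) : Prop := A ≠ B ∧ (A ∩ B).Nonempty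

/-- The graph on the centers of the `0`-complexes contained in `K^⟨1⟩`, two centers being joined
when they are the centers of adjacent complexes. Its walks are the paths made of vectors that
connect centers of adjacent complexes. -/
def centerGraph : SimpleGraph S.centers where
  Adj p q := p ≠ q ∧ ∃ c ∈ S.innerShifts, ∃ d ∈ S.innerShifts,
    (p : ℂ) = S.barycenter 0 c ∧ (q : ℂ) = S.barycenter 0 d ∧
      Adjacent (S.cell 0 c) (S.cell 0 d)
  symm := ⟨fun _ _ ⟨h, c, hc, d, hd, hp, hq, hn, hi⟩ =>
    ⟨h.symm, d, hd, c, hc, hq, hp, hn.symm, Set.inter_comm _ _ ▸ hi⟩⟩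
  loopless := ⟨fun _ h => h.1 rfl⟩

end SimSystem

end NestedFractal

end

open scoped ComplexConjugate

namespace NestedFractal

/-! All the reflections fix one point `b`, and `exists_polygon` deduces that the set `V` of
essential fixed points is a regular `k`-gon about `b`. As `k` is even, the half-turn about `b`
preserves `V` and permutes the cells. If distinct cells meet, `Ψ i x = Ψ j y`, then `x + y = 2b`
(`add_eq_of_Ψ_eq`): otherwise contracting towards `x` and `y` yields infinitely many common points,
while nesting allows only finitely many. Comparing addresses extends this to all complexes
(`address_of_add_shift_eq`).

A good labelling attaches a `k`-th root of unity to each complex. At a vertex shared by adjacent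
complexes the labels agree but the positions relative to `b` are opposite, so the root changes sign.
Along a closed path of length `n` it is multiplied by `(-1)^n`, so `n` is even.

Conversely, a bipartition is a coloring `χ` of the cells in `ZMod 2`. By connectivity the half-turn
changes `χ` by a constant `t`. The complex with digits `i 0, i 1, ...` receives the color `χ (i 0) +
(1 + t) * (χ (i 1) + χ (i 2) + ...)`; the factor `1 + t` makes it change between any two adjacent
complexes (`color_eq_add_one`). Copying the labels of `V` to complexes of color `0`, and turning
them by a half-turn on the others, is then consistent at shared vertices. -/

/-! ### Reflections in complex coordinates. -/

theorem bisectorReflection_apply {x y : ℂ} (hxy : x ≠ y) (z : ℂ) :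
    bisectorReflection x y z =
      (x + y) / 2 - (y - x) / conj (y - x) * conj (z - (x + y) / 2) := by
  have : Nonempty (AffineSubspace.perpBisector x y) :=
    AffineSubspace.perpBisector_nonempty.to_subtype
  have hu : y - x ≠ 0 := sub_ne_zero.2 hxy.symm
  have hu' : conj (y - x) ≠ 0 := (map_ne_zero _).2 hu
  have hn : Complex.normSq (y - x) ≠ 0 := Complex.normSq_eq_zero.not.2 hu
  -- The multiple of `y - x` to subtract from `z` to reach the foot of its perpendicular on the
  -- bisector.
  set t : ℝ := ((z - (x + y) / 2) * conj (y - x)).re / Complex.normSq (y - x) with ht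
  have hmid : midpoint ℝ x y = (x + y) / 2 := by
    rw [midpoint_eq_smul_add, Complex.real_smul]
    simp; ring
  have h2t : (2 * t : ℂ) * (y - x) =
      (z - (x + y) / 2) + (y - x) / conj (y - x) * conj (z - (x + y) / 2) := by
    have h1 : (2 * (((z - (x + y) / 2) * conj (y - x)).re : ℝ) : ℂ) =
        (z - (x + y) / 2) * conj (y - x) + conj (z - (x + y) / 2) * (y - x) := by
      have := Complex.add_conj ((z - (x + y) / 2) * conj (y - x))
      rw [map_mul, Complex.conj_conj] at this
      rw [this]; push_cast; ring
    rw [ht, Complex.ofReal_div, ← mul_div_assoc, h1, ← Complex.mul_conj]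
    field_simp
  have hp : z - (t : ℂ) * (y - x) ∈ AffineSubspace.perpBisector x y := by
    rw [AffineSubspace.mem_perpBisector_iff_inner_eq_zero, hmid, vsub_eq_sub, vsub_eq_sub,
      Complex.inner]
    have h3 : (z - t * (y - x) - (x + y) / 2) * conj (y - x) =
        (z - (x + y) / 2) * conj (y - x) - ((t * Complex.normSq (y - x) : ℝ) : ℂ) := by
      rw [Complex.ofReal_mul, ← Complex.mul_conj]; ring
    have h4 : t * Complex.normSq (y - x) = ((z - (x + y) / 2) * conj (y - x)).re := by
      rw [ht]; field_simp
    rw [← Complex.conj_re, map_mul, Complex.conj_conj, mul_comm, h3, h4, Complex.sub_re,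
      Complex.ofReal_re, sub_self]
  have hv : (t : ℂ) * (y - x) ∈ (AffineSubspace.perpBisector x y).directionᗮ := by
    rw [AffineSubspace.direction_perpBisector, ← Complex.real_smul]
    apply Submodule.le_orthogonal_orthogonal
    exact Submodule.smul_mem _ _ (Submodule.mem_span_singleton_self _)
  have hr := EuclideanGeometry.reflection_orthogonal_vadd hp hv
  simp only [vadd_eq_add] at hr
  rw [add_sub_cancel] at hr
  unfold bisectorReflection
  rw [hr]
  linear_combination -h2t

theorem bisectorReflection_left {x y : ℂ} (hxy : x ≠ y) : bisectorReflection x y x = y := by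
  have hu' : conj (y - x) ≠ 0 := (map_ne_zero _).2 (sub_ne_zero.2 hxy.symm)
  rw [bisectorReflection_apply hxy]
  have : conj (x - (x + y) / 2) = -(conj (y - x)) / 2 := by
    simp only [map_sub, map_div₀, map_add, Complex.conj_ofNat]; ring
  rw [this]
  field_simp
  ring

theorem dist_bisectorReflection {x y : ℂ} (z w : ℂ) :
    ‖bisectorReflection x y z - bisectorReflection x y w‖ = ‖z - w‖ := by
  have : Nonempty (AffineSubspace.perpBisector x y) :=
    AffineSubspace.perpBisector_nonempty.to_subtype
  rw [← dist_eq_norm, ← dist_eq_norm]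
  exact (EuclideanGeometry.reflection (AffineSubspace.perpBisector x y)).dist_map z w

/-- A finite set invariant under a reflection has a barycenter fixed by it. -/
theorem bisectorReflection_average {x y : ℂ} (hxy : x ≠ y) (F : Finset ℂ) (hF : F.Nonempty)
    (h : ∀ z ∈ F, bisectorReflection x y z ∈ F) :
    bisectorReflection x y ((∑ z ∈ F, z) / F.card) = (∑ z ∈ F, z) / F.card := by
  have hc : (F.card : ℂ) ≠ 0 := by exact_mod_cast hF.card_pos.ne'
  have hinj : Function.Injective (bisectorReflection x y) := fun z w hzw => by
    have := dist_bisectorReflection (x := x) (y := y) z w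
    rw [hzw, sub_self, norm_zero] at this
    exact sub_eq_zero.1 (norm_eq_zero.1 this.symm)
  have himg : F.image (bisectorReflection x y) = F :=
    Finset.eq_of_subset_of_card_le (Finset.image_subset_iff.2 h)
      (Finset.card_image_of_injective _ hinj).ge
  have hsum : ∑ z ∈ F, bisectorReflection x y z = ∑ z ∈ F, z := by
    conv_rhs => rw [← himg]
    rw [Finset.sum_image fun a _ b _ hab => hinj hab]
  have hlin : ∑ z ∈ F, bisectorReflection x y z =
      F.card * bisectorReflection x y ((∑ z ∈ F, z) / F.card) := by
    simp only [bisectorReflection_apply hxy, Finset.sum_sub_distrib, Finset.sum_const,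
      nsmul_eq_mul, ← Finset.mul_sum, map_sub, map_div₀, map_sum, map_natCast]
    field_simp
  rw [eq_div_iff hc, mul_comm, ← hlin, hsum]

/-! ### Rigidity of finite sets on a circle. -/

/-- Three points on a circle about `0` cannot stay on it after a nonzero translation. -/
theorem translation_eq_zero {r : ℝ} {h : ℂ} {F : Finset ℂ} (hF : 3 ≤ F.card)
    (hr : ∀ w ∈ F, ‖w‖ = r) (hh : ∀ w ∈ F, ‖w + h‖ = r) : h = 0 := by
  by_contra h0
  have hc : conj h ≠ 0 := (map_ne_zero _).2 h0
  -- Eliminating `conj w` from the two circle equations leaves a quadratic in `w`, which cannot have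
  -- three roots.
  have hq : ∀ w ∈ F, conj h * w ^ 2 + h * conj h * w + r ^ 2 * h = 0 := by
    intro w hw
    have h1 : w * conj w = (r : ℂ) ^ 2 := by
      rw [Complex.mul_conj, Complex.normSq_eq_norm_sq, hr w hw]; push_cast; rfl
    have h2 : (w + h) * (conj w + conj h) = (r : ℂ) ^ 2 := by
      rw [← map_add, Complex.mul_conj, Complex.normSq_eq_norm_sq, hh w hw]; push_cast; rfl
    linear_combination w * h2 - (w + h) * h1
  obtain ⟨a, ha, b, hb, c, hc', hab, hac, hbc⟩ := Finset.two_lt_card.1 hF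
  have e1 : conj h * (a + b) + h * conj h = 0 := by
    apply mul_left_cancel₀ (sub_ne_zero.2 hab)
    linear_combination hq a ha - hq b hb
  have e2 : conj h * (a + c) + h * conj h = 0 := by
    apply mul_left_cancel₀ (sub_ne_zero.2 hac)
    linear_combination hq a ha - hq c hc'
  apply hbc
  apply mul_left_cancel₀ hc
  linear_combination e1 - e2

/-- A finite set of nonzero numbers closed under `X * Y / Z`, `X ≠ Y`, is a coset of a group of
roots of unity. -/
theorem root_mul_mem {F : Finset ℂ} (hF : 3 ≤ F.card) (h0 : ∀ w ∈ F, w ≠ 0)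
    (hT : ∀ X ∈ F, ∀ Y ∈ F, X ≠ Y → ∀ Z ∈ F, X * Y / Z ∈ F) {z : ℂ} (hz : z ^ F.card = 1)
    {w : ℂ} (hw : w ∈ F) : z * w ∈ F := by
  have hmul : ∀ p ∈ F, ∀ X ∈ F, X / w * p ∈ F := by
    intro p hp X hX
    rw [div_mul_eq_mul_div]
    by_cases hXp : X = p
    · subst hXp
      by_cases hXw : X = w
      · subst hXw; rwa [mul_div_cancel_right₀ _ (h0 _ hX)]
      obtain ⟨y, hy, hyw, hyX⟩ : ∃ y ∈ F, y ≠ w ∧ y ≠ X := by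
        have : (({w, X} : Finset ℂ)).card < F.card := by
          have := Finset.card_le_two (a := w) (b := X); omega
        obtain ⟨y, hy, hn⟩ := Finset.exists_mem_notMem_of_card_lt_card this
        simp only [Finset.mem_insert, Finset.mem_singleton, not_or] at hn
        exact ⟨y, hy, hn.1, hn.2⟩
      have hX0 := h0 _ hX
      have hw0 := h0 _ hw
      have hy0 := h0 _ hy
      have h1 : w * y / X ∈ F := hT _ hw _ hy hyw.symm _ hX
      -- The closure property excludes `X * X / w`, so the square is reached through a third element
      -- `y`: first `w * y / X`, then `w ^ 2 / X`, then `w * X / (w ^ 2 / X)`.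
      have h2 : w ^ 2 / X ∈ F := by
        have := hT w hw _ h1 (fun h => hyX ?_) y hy
        · convert this using 1; field_simp
        · rw [eq_div_iff hX0] at h
          exact (mul_left_cancel₀ hw0 h).symm
      have := hT w hw X hX (Ne.symm hXw) _ h2
      convert this using 1
      field_simp
    · exact hT X hX p hp hXp w hw
  have hpow : ∀ X ∈ F, (X / w) ^ F.card = 1 := by
    intro X hX
    have hXw : X / w ≠ 0 := div_ne_zero (h0 _ hX) (h0 _ hw)
    have himg : F.image (fun p => X / w * p) = F :=
      Finset.eq_of_subset_of_card_le (Finset.image_subset_iff.2 fun p hp => hmul p hp X hX)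
        (Finset.card_image_of_injective _ (mul_right_injective₀ hXw)).ge
    -- Multiplication by `X / w` permutes `F`; comparing products forces a root of unity, and a
    -- count then gives all of them.
    have hprod : ∏ p ∈ F, (X / w * p) = ∏ p ∈ F, p := by
      conv_rhs => rw [← himg]
      rw [Finset.prod_image fun a _ b _ hab => mul_right_injective₀ hXw hab]
    rw [Finset.prod_mul_distrib, Finset.prod_const] at hprod
    exact mul_right_cancel₀ (Finset.prod_ne_zero_iff.2 h0) (hprod.trans (one_mul _).symm)
  have hpos : 0 < F.card := by omega
  have hsub : F.image (fun X => X / w) ⊆ Polynomial.nthRootsFinset F.card (1 : ℂ) := by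
    rw [Finset.image_subset_iff]
    exact fun X hX => (Polynomial.mem_nthRootsFinset hpos 1).2 (hpow X hX)
  have heq : F.image (fun X => X / w) = Polynomial.nthRootsFinset F.card (1 : ℂ) := by
    refine Finset.eq_of_subset_of_card_le hsub ?_
    rw [Finset.card_image_of_injective _ (fun a b hab => (div_left_inj' (h0 _ hw)).1 hab)]
    classical
    rw [Polynomial.nthRootsFinset_def]
    exact (Multiset.toFinset_card_le _).trans (Polynomial.card_nthRoots _ _)
  have hzm := (Polynomial.mem_nthRootsFinset hpos 1).2 hz
  rw [← heq] at hzm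
  obtain ⟨X, hX, rfl⟩ := Finset.mem_image.1 hzm
  rwa [div_mul_cancel₀ _ (h0 _ hw)]

namespace SimSystem

variable {S : SimSystem}

/-! ### The regular polygon of essential fixed points. -/

theorem Ψ_sub (i : Fin S.N) (z w : ℂ) : S.Ψ i z - S.Ψ i w = (z - w) / S.L := by
  simp only [Ψ]; ring

theorem Ψ_injective (i : Fin S.N) : Function.Injective (S.Ψ i) := fun z w h => by
  have := Ψ_sub i z w
  rw [h, sub_self, eq_comm, div_eq_zero_iff] at this
  exact sub_eq_zero.1 (this.resolve_right S.L_ne)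

theorem finite_fixedPts : S.fixedPts.Finite := by
  have hL : (S.L : ℂ) - 1 ≠ 0 := by
    have := S.one_lt_L
    exact_mod_cast (sub_pos.2 this).ne'
  refine (Set.finite_range fun i => S.ν i * S.L / (S.L - 1)).subset ?_
  rintro x ⟨i, hi⟩
  refine ⟨i, ?_⟩
  have hL' := S.L_ne
  simp only [Ψ] at hi
  rw [div_eq_iff hL]
  field_simp at hi
  linear_combination hi

theorem finite_essentialPts : S.essentialPts.Finite :=
  finite_fixedPts.subset fun _ h => h.1

namespace IsSimpleNestedFractal

/-- This is the only use of the open set condition: equal translations would give the same image of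
`U`. -/
theorem ν_injective (hS : S.IsSimpleNestedFractal) : Function.Injective S.ν := by
  obtain ⟨U, -, ⟨u, hu⟩, hd, -⟩ := hS.open_set
  intro i j hij
  by_contra hne
  have : S.Ψ i u ∈ S.Ψ i '' U ∩ S.Ψ j '' U :=
    ⟨⟨u, hu, rfl⟩, ⟨u, hu, by simp only [Ψ, hij]⟩⟩
  rw [hd i j hne] at this
  exact this

/-- The common fixed point of all the reflections. -/
theorem exists_center (hS : S.IsSimpleNestedFractal) : ∃ b : ℂ, ∀ x ∈ S.essentialPts,
    ∀ y ∈ S.essentialPts, x ≠ y → bisectorReflection x y b = b := by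
  classical
  have hne : S.essentialPts.Nonempty := by
    apply Set.nonempty_of_ncard_ne_zero
    have := hS.two_le_k
    unfold k at this
    omega
  obtain ⟨v, hv⟩ := hne
  -- The symmetry axiom concerns the cells, not `V` itself, so the average is taken over the
  -- vertices of all cells.
  let F : Finset ℂ := Finset.univ.biUnion fun i =>
    (finite_essentialPts (S := S)).toFinset.image (S.Ψ i)
  have hmem : ∀ z, z ∈ F ↔ ∃ i, ∃ v ∈ S.essentialPts, S.Ψ i v = z := fun z => by simp [F]
  refine ⟨(∑ z ∈ F, z) / F.card, fun x hx y hy hxy => bisectorReflection_average hxy F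
    ⟨_, (hmem _).2 ⟨⟨0, S.N_pos⟩, v, hv, rfl⟩⟩ fun z hz => ?_⟩
  obtain ⟨i, v, hv, rfl⟩ := (hmem z).1 hz
  obtain ⟨j, hj⟩ := hS.symmetry i x hx y hy hxy
  have : bisectorReflection x y (S.Ψ i v) ∈ S.Ψ j '' S.essentialPts := hj ▸ ⟨_, ⟨v, hv, rfl⟩, rfl⟩
  obtain ⟨w, hw, h⟩ := this
  exact (hmem _).2 ⟨j, w, hw, h⟩

/-- The essential fixed points are the vertices of a regular polygon, and the cells are permuted by
the central symmetry when their number is even. -/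
theorem exists_polygon (hS : S.IsSimpleNestedFractal) (hk : 3 ≤ S.k) (heven : Even S.k) :
    ∃ b : ℂ, (∀ x ∈ S.essentialPts, x ≠ b) ∧
      (∀ z : ℂ, z ^ S.k = 1 → ∀ x ∈ S.essentialPts, b + z * (x - b) ∈ S.essentialPts) ∧
      ∀ i, ∃ j, S.Ψ j b - b = -(S.Ψ i b - b) := by
  classical
  obtain ⟨b, hb⟩ := hS.exists_center
  have hcard : finite_essentialPts.toFinset.card = S.k :=
    (Set.ncard_eq_toFinset_card _ finite_essentialPts).symm
  set F : Finset ℂ := finite_essentialPts.toFinset.image (fun x => x - b) with hFdef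
  have hF : F.card = S.k := by
    rw [hFdef, Finset.card_image_of_injective _ sub_left_injective, hcard]
  have hmem : ∀ w, w ∈ F ↔ b + w ∈ S.essentialPts := fun w => by
    simp only [hFdef, Finset.mem_image, Set.Finite.mem_toFinset]
    exact ⟨fun ⟨x, hx, h⟩ => by rwa [← h, add_sub_cancel], fun h => ⟨_, h, add_sub_cancel_left _ _⟩⟩
  have hnorm : ∀ X ∈ F, ∀ Y ∈ F, ‖X‖ = ‖Y‖ := by
    intro X hX Y hY
    by_cases hXY : X = Y
    · rw [hXY]
    have hne : b + X ≠ b + Y := fun h => hXY (add_left_cancel h)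
    have := dist_bisectorReflection (x := b + X) (y := b + Y) (b + X) b
    rw [bisectorReflection_left hne, hb _ ((hmem X).1 hX) _ ((hmem Y).1 hY) hne,
      add_sub_cancel_left, add_sub_cancel_left] at this
    exact this.symm
  obtain ⟨X₀, hX₀⟩ : F.Nonempty := Finset.card_pos.1 (by omega)
  set r := ‖X₀‖ with hrdef
  have hr : ∀ w ∈ F, ‖w‖ = r := fun w hw => hnorm w hw X₀ hX₀
  have hF0 : ∀ w ∈ F, w ≠ 0 := by
    rintro w hw rfl
    obtain ⟨Y, hY, hYn⟩ := Finset.exists_mem_ne (by omega : 1 < F.card) 0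
    exact hYn (norm_eq_zero.1 ((hnorm Y hY 0 hw).trans norm_zero))
  have hr0 : (r : ℂ) ^ 2 ≠ 0 := by
    have : r ≠ 0 := norm_ne_zero_iff.2 (hF0 _ hX₀)
    exact_mod_cast pow_ne_zero 2 this
  have hconj : ∀ w ∈ F, w * conj w = (r : ℂ) ^ 2 := fun w hw => by
    rw [Complex.mul_conj, Complex.normSq_eq_norm_sq, hr w hw]; push_cast; rfl
  have key : ∀ X ∈ F, ∀ Y ∈ F, X ≠ Y → ∀ i, (∀ Z ∈ F, X * Y / Z ∈ F) ∧
      ∃ j, S.Ψ j b - b = X * Y / r ^ 2 * conj (S.Ψ i b - b) := by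
    intro X hX Y hY hXY i
    have hne : b + X ≠ b + Y := fun h => hXY (add_left_cancel h)
    have hX' := (hmem X).1 hX
    have hY' := (hmem Y).1 hY
    have hRb := hb _ hX' _ hY' hne
    have hRx := bisectorReflection_left hne
    have hcX : conj X ≠ 0 := (map_ne_zero _).2 (hF0 X hX)
    -- A reflection that fixes `b` is conjugation about `b` times a unit number, determined here by
    -- sending `X` to `Y`.
    have hform : ∀ z, bisectorReflection (b + X) (b + Y) z =
        b + X * Y / r ^ 2 * conj (z - b) := by
      intro z
      rw [bisectorReflection_apply hne] at hRb hRx ⊢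
      set β := (b + Y - (b + X)) / conj (b + Y - (b + X))
      have hβ : -β = X * Y / r ^ 2 := by
        rw [eq_div_iff hr0, ← hconj X hX]
        simp only [map_sub, map_div₀, map_add] at hRx hRb
        linear_combination X * hRx - X * hRb
      rw [← hβ]
      simp only [map_sub, map_div₀, map_add] at hRb ⊢
      linear_combination hRb
    set β := X * Y / (r : ℂ) ^ 2 with hβ
    have hβn : β ≠ 0 := div_ne_zero (mul_ne_zero (hF0 X hX) (hF0 Y hY)) hr0
    obtain ⟨j, hj⟩ := hS.symmetry i _ hX' _ hY' hne
    have hL := S.L_ne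
    -- The defect between the reflected center of cell `i` and the center of cell `j`, rescaled by
    -- `L`. It translates one `k`-point subset of the circle of radius `r` into that circle, so it
    -- vanishes.
    set h := S.L * (β * conj (S.Ψ i b - b) - (S.Ψ j b - b)) with hh
    have hmap : ∀ w ∈ F, β * conj w + h ∈ F := by
      intro w hw
      have : bisectorReflection (b + X) (b + Y) (S.Ψ i (b + w)) ∈ S.Ψ j '' S.essentialPts :=
        hj ▸ ⟨_, ⟨_, (hmem w).1 hw, rfl⟩, rfl⟩
      obtain ⟨v, hv, hvw⟩ := this
      rw [hform] at hvw
      rw [hmem]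
      convert hv using 1
      have h1 := Ψ_sub i (b + w) b
      have h2 := Ψ_sub j v b
      rw [add_sub_cancel_left, sub_eq_iff_eq_add] at h1
      rw [eq_div_iff hL] at h2
      rw [h1] at hvw
      simp only [map_add, map_sub, map_div₀, Complex.conj_ofReal] at hvw
      rw [hh, map_sub]
      have h3 : conj w / (S.L : ℂ) * S.L = conj w := div_mul_cancel₀ _ hL
      linear_combination h2 - S.L * hvw - β * h3
    have hh0 : h = 0 := by
      refine translation_eq_zero (r := r) (F := F.image fun w => β * conj w) ?_ ?_ ?_
      · rw [Finset.card_image_of_injective, hF]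
        · exact hk
        · exact fun a c hac => (starRingEnd ℂ).injective (mul_left_cancel₀ hβn hac)
      · intro z hz
        obtain ⟨w, hw, rfl⟩ := Finset.mem_image.1 hz
        rw [norm_mul, RCLike.norm_conj, hr w hw, hβ, norm_div, norm_mul, hr X hX, hr Y hY, norm_pow,
          Complex.norm_real, Real.norm_of_nonneg (norm_nonneg _), ← pow_two, div_self, one_mul]
        exact_mod_cast hr0
      · intro z hz
        obtain ⟨w, hw, rfl⟩ := Finset.mem_image.1 hz
        exact hr _ (hmap w hw)
    refine ⟨fun Z hZ => ?_, j, ?_⟩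
    · have := hmap Z hZ
      rw [hh0, add_zero, hβ, ← hconj Z hZ] at this
      have hZ0 := hF0 Z hZ
      have hcZ : conj Z ≠ 0 := (map_ne_zero _).2 hZ0
      convert this using 1
      field_simp
    · rw [hh] at hh0
      exact (sub_eq_zero.1 ((mul_eq_zero.1 hh0).resolve_left hL)).symm
  have hrot : ∀ z : ℂ, z ^ S.k = 1 → ∀ w ∈ F, z * w ∈ F := fun z hz w hw =>
    root_mul_mem (by omega) hF0
      (fun X hX Y hY hXY => (key X hX Y hY hXY ⟨0, S.N_pos⟩).1) (hF.symm ▸ hz) hw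
  refine ⟨b, fun x hx hxb => ?_, fun z hz x hx => ?_, fun i => ?_⟩
  · exact hF0 0 ((hmem 0).2 (by rwa [add_zero, ← hxb])) rfl
  · exact (hmem _).1 (hrot z hz _ ((hmem _).2 (by rwa [add_sub_cancel])))
  · have hneg : ∀ w ∈ F, -w ∈ F := fun w hw => by
      have := hrot (-1) heven.neg_one_pow w hw
      rwa [neg_one_mul] at this
    -- With `Y` different from `X₀` and `-X₀`, both pairs `X₀, Y` and `X₀, -Y` define reflections;
    -- their multipliers are opposite, so their composite is the half-turn.
    obtain ⟨Y, hY, hYX⟩ : ∃ Y ∈ F, Y ∉ ({X₀, -X₀} : Finset ℂ) := by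
      apply Finset.exists_mem_notMem_of_card_lt_card
      have := Finset.card_le_two (a := X₀) (b := -X₀)
      omega
    simp only [Finset.mem_insert, Finset.mem_singleton, not_or] at hYX
    obtain ⟨j, hj⟩ := (key X₀ hX₀ Y hY (Ne.symm hYX.1) i).2
    obtain ⟨l, hl⟩ := (key X₀ hX₀ (-Y) (hneg Y hY) (fun h => hYX.2 (by rw [h, neg_neg])) j).2
    refine ⟨l, ?_⟩
    rw [hl, hj]
    simp only [map_mul, map_div₀, map_pow, Complex.conj_ofReal, Complex.conj_conj]
    have h1 := hconj X₀ hX₀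
    have h2 := hconj Y hY
    calc _ = -(X₀ * conj X₀ * (Y * conj Y) / (r ^ 2 * r ^ 2) * (S.Ψ i b - b)) := by ring
      _ = _ := by rw [h1, h2, div_self (mul_ne_zero hr0 hr0), one_mul]

end IsSimpleNestedFractal

/-! ### How cells meet. -/

theorem one_lt_norm_L : 1 < ‖(S.L : ℂ)‖ := by
  rw [Complex.norm_real, Real.norm_of_nonneg S.L_pos.le]; exact S.one_lt_L

theorem Ψ_add (i : Fin S.N) (z w : ℂ) : S.Ψ i (z + w) = S.Ψ i z + w / S.L := by
  simp only [Ψ]; ring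

theorem Ψ_mem {x : ℂ} (hx : x ∈ S.fractal) (i : Fin S.N) : S.Ψ i x ∈ S.fractal := by
  rw [S.isAttractor_fractal.2.2]
  exact Set.mem_iUnion.2 ⟨i, x, hx, rfl⟩

/-- The distance from a fixed point to the attractor is at most itself divided by `L`, hence zero.
-/
theorem fixedPts_subset : S.fixedPts ⊆ S.fractal := by
  rintro x ⟨i, hi⟩
  obtain ⟨hn, hc, -⟩ := S.isAttractor_fractal
  obtain ⟨a, ha, hd⟩ := hc.exists_infDist_eq_dist hn x
  have h1 : Metric.infDist x S.fractal ≤ dist x (S.Ψ i a) :=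
    Metric.infDist_le_dist_of_mem (Ψ_mem ha i)
  have h2 : dist x (S.Ψ i a) = dist x a / S.L := by
    conv_lhs => rw [← hi]
    rw [dist_eq_norm, Ψ_sub, norm_div, Complex.norm_real, Real.norm_of_nonneg S.L_pos.le,
      dist_eq_norm]
  rw [h2, ← hd, le_div_iff₀ S.L_pos] at h1
  rw [hc.isClosed.mem_iff_infDist_zero hn]
  have := S.one_lt_L
  have h0 : 0 ≤ Metric.infDist x S.fractal := Metric.infDist_nonneg
  nlinarith

theorem essentialPts_subset : S.essentialPts ⊆ S.fractal := fun _ h => fixedPts_subset h.1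

/-- The map fixing `v` contracts the fractal towards `v`; it is iterated `n` times. -/
theorem add_div_pow_mem {v p : ℂ} (hv : v ∈ S.essentialPts) (hp : v + p ∈ S.fractal) (n : ℕ) :
    v + p / (S.L : ℂ) ^ n ∈ S.fractal := by
  induction n with
  | zero => simpa using hp
  | succ n ih =>
    obtain ⟨m, hm⟩ := hv.1
    have := Ψ_mem ih m
    rwa [Ψ_add, hm, div_div, ← pow_succ] at this

theorem barycenter_eq (M : ℤ) (c : ℂ) (hk : S.k ≠ 0) :
    S.barycenter M c = (S.L : ℂ) ^ M * S.barycenter 0 0 + c := by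
  have hinj : ∀ (M : ℤ) (c : ℂ), Function.Injective fun z : ℂ => (S.L : ℂ) ^ M * z + c :=
    fun M c z w h => mul_left_cancel₀ (zpow_ne_zero M S.L_ne) (add_right_cancel h)
  have hk' : (S.k : ℂ) ≠ 0 := by exact_mod_cast hk
  have key : ∀ (M : ℤ) (c : ℂ), S.barycenter M c =
      (S.L : ℂ) ^ M * ((∑ z ∈ (finite_essentialPts (S := S)).toFinset, z) / S.k) + c := by
    intro M c
    have hcard : ((finite_essentialPts (S := S)).toFinset.card : ℂ) = S.k := by
      rw [k, Set.ncard_eq_toFinset_card _ finite_essentialPts]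
    unfold barycenter cellVertices
    rw [Set.ncard_image_of_injective _ (hinj M c), finsum_mem_image (hinj M c).injOn,
      finsum_mem_eq_finite_toFinset_sum _ finite_essentialPts, Finset.sum_add_distrib,
      ← Finset.mul_sum, Finset.sum_const, nsmul_eq_mul, hcard]
    change _ / (S.k : ℂ) = _
    field_simp
  rw [key M c, key 0 0, zpow_zero, one_mul, add_zero]

/-- The half-turn invariance of `V` identifies the fixed point of the reflections with the
barycenter of `V`. -/
theorem centre_spec (hS : S.IsSimpleNestedFractal) (hk : 3 ≤ S.k) (heven : Even S.k) :
    (∀ x ∈ S.essentialPts, x ≠ S.barycenter 0 0) ∧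
      (∀ z : ℂ, z ^ S.k = 1 → ∀ x ∈ S.essentialPts,
        S.barycenter 0 0 + z * (x - S.barycenter 0 0) ∈ S.essentialPts) ∧
      ∀ i, ∃ j, ∀ x, S.Ψ j (2 * S.barycenter 0 0 - x) = 2 * S.barycenter 0 0 - S.Ψ i x := by
  obtain ⟨b, h1, h2, h3⟩ := hS.exists_polygon hk heven
  have hsymm : ∀ x ∈ S.essentialPts, 2 * b - x ∈ S.essentialPts := fun x hx => by
    convert h2 (-1) heven.neg_one_pow x hx using 1; ring
  have hb : S.barycenter 0 0 = b := by
    have hk' : (S.k : ℂ) ≠ 0 := by exact_mod_cast (by omega : S.k ≠ 0)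
    have hV : S.cellVertices 0 0 = S.essentialPts := by simp [cellVertices]
    have hcard : ((finite_essentialPts (S := S)).toFinset.card : ℂ) = S.k := by
      rw [k, Set.ncard_eq_toFinset_card _ finite_essentialPts]
    have hsum : ∑ x ∈ (finite_essentialPts (S := S)).toFinset, x =
        ∑ x ∈ (finite_essentialPts (S := S)).toFinset, (2 * b - x) := by
      refine Finset.sum_nbij' (fun x => 2 * b - x) (fun x => 2 * b - x) ?_ ?_ ?_ ?_ ?_ <;>
        simp +contextual [hsymm]
    rw [Finset.sum_sub_distrib, Finset.sum_const, nsmul_eq_mul, hcard] at hsum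
    unfold barycenter
    rw [hV, finsum_mem_eq_finite_toFinset_sum _ finite_essentialPts]
    change _ / (S.k : ℂ) = _
    rw [div_eq_iff hk']
    linear_combination hsum / 2
  rw [hb]
  refine ⟨h1, h2, fun i => ?_⟩
  obtain ⟨j, hj⟩ := h3 i
  refine ⟨j, fun x => ?_⟩
  have e1 := Ψ_sub j (2 * b - x) b
  have e2 := Ψ_sub i x b
  linear_combination e1 + e2 + hj

theorem rotation_mem (hS : S.IsSimpleNestedFractal) (hk : 3 ≤ S.k) (heven : Even S.k) {z x : ℂ}
    (hz : z ^ S.k = 1) (hx : x ∈ S.essentialPts) :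
    S.barycenter 0 0 + z * (x - S.barycenter 0 0) ∈ S.essentialPts :=
  (centre_spec hS hk heven).2.1 z hz x hx

theorem antipode_mem (hS : S.IsSimpleNestedFractal) (hk : 3 ≤ S.k) (heven : Even S.k) {x : ℂ}
    (hx : x ∈ S.essentialPts) : 2 * S.barycenter 0 0 - x ∈ S.essentialPts := by
  convert rotation_mem hS hk heven heven.neg_one_pow hx using 1; ring

/-- Two cells meet at finitely many points, so their copies at a common point share no other point
of their tangent cones. -/
theorem eq_zero_of_common_direction (hS : S.IsSimpleNestedFractal) {i j : Fin S.N} (hij : i ≠ j)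
    {x y p : ℂ} (hx : x ∈ S.essentialPts) (hy : y ∈ S.essentialPts) (hxy : S.Ψ i x = S.Ψ j y)
    (hxp : x + p ∈ S.fractal) (hyp : y + p ∈ S.fractal) : p = 0 := by
  by_contra hp
  have hfin : (S.Ψ i '' S.essentialPts ∩ S.Ψ j '' S.essentialPts).Finite :=
    (finite_essentialPts.image _).inter_of_left _
  refine Set.infinite_of_injective_forall_mem (f := fun n : ℕ => S.Ψ i (x + p / (S.L : ℂ) ^ n))
    (fun a c hac => ?_) (fun n => ?_) hfin
  · have h := add_left_cancel (Ψ_injective i hac)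
    rw [div_eq_mul_inv, div_eq_mul_inv] at h
    have h' := congrArg norm (inv_injective (mul_left_cancel₀ hp h))
    rw [norm_pow, norm_pow] at h'
    exact pow_right_injective₀ (zero_lt_one.trans one_lt_norm_L) one_lt_norm_L.ne' h'
  · rw [← hS.nesting i j hij]
    refine ⟨⟨_, add_div_pow_mem hx hxp n, rfl⟩, ⟨_, add_div_pow_mem hy hyp n, ?_⟩⟩
    rw [Ψ_add, Ψ_add, hxy]

/-- Adjacent cells meet at opposite vertices. -/
theorem add_eq_of_Ψ_eq (hS : S.IsSimpleNestedFractal) (hk : 3 ≤ S.k) (heven : Even S.k)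
    {i j : Fin S.N} (hij : i ≠ j) {x y : ℂ} (hx : x ∈ S.essentialPts) (hy : y ∈ S.essentialPts)
    (hxy : S.Ψ i x = S.Ψ j y) : x + y = 2 * S.barycenter 0 0 := by
  have := eq_zero_of_common_direction hS hij hx hy hxy (p := 2 * S.barycenter 0 0 - x - y)
    (by convert essentialPts_subset (antipode_mem hS hk heven hy) using 1; ring)
    (by convert essentialPts_subset (antipode_mem hS hk heven hx) using 1; ring)
  linear_combination -this

theorem mem_of_Ψ_eq (hS : S.IsSimpleNestedFractal) {i j : Fin S.N} (hij : i ≠ j) {x y : ℂ}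
    (hx : x ∈ S.fractal) (hy : y ∈ S.fractal) (hxy : S.Ψ i x = S.Ψ j y) :
    x ∈ S.essentialPts ∧ y ∈ S.essentialPts := by
  have h : S.Ψ i x ∈ S.Ψ i '' S.fractal ∩ S.Ψ j '' S.fractal := ⟨⟨x, hx, rfl⟩, ⟨y, hy, hxy.symm⟩⟩
  rw [hS.nesting i j hij] at h
  obtain ⟨⟨x', hx', h1⟩, ⟨y', hy', h2⟩⟩ := h
  exact ⟨Ψ_injective i h1 ▸ hx', Ψ_injective j (h2.trans hxy) ▸ hy'⟩

/-- An essential fixed point lies in only one cell. -/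
theorem eq_of_Ψ_mem_essentialPts (hS : S.IsSimpleNestedFractal) (hk : 3 ≤ S.k) (heven : Even S.k)
    {i : Fin S.N} {v q : ℂ} (hv : v ∈ S.essentialPts) (hq : q ∈ S.fractal) (h : S.Ψ i q = v) :
    q = v := by
  obtain ⟨m, hm⟩ := hv.1
  by_cases him : i = m
  · exact Ψ_injective i (by rw [h, him, hm])
  have hq' := (mem_of_Ψ_eq hS him hq (essentialPts_subset hv) (h.trans hm.symm)).1
  have hsum := add_eq_of_Ψ_eq hS hk heven him hq' hv (h.trans hm.symm)
  -- The common displacement is `(v - q) / L`: from `q` it is the contraction of `v` towards `q`,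
  -- and from `v = Ψ i q` it leads to `Ψ i v`.
  have h1 : q + (v - q) / (S.L : ℂ) ^ 1 ∈ S.fractal :=
    add_div_pow_mem hq' (by rw [add_sub_cancel]; exact essentialPts_subset hv) 1
  have h2 : v + (v - q) / (S.L : ℂ) ^ 1 ∈ S.fractal := by
    have := Ψ_mem (essentialPts_subset hv) i
    have e := Ψ_sub i v q
    rw [h, sub_eq_iff_eq_add'] at e
    rwa [pow_one, ← e]
  have := eq_zero_of_common_direction hS him hq' hv (h.trans hm.symm) h1 h2
  rw [div_eq_zero_iff] at this
  exact (sub_eq_zero.1 (this.resolve_right (pow_ne_zero _ S.L_ne))).symm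

/-! ### Addresses of complexes. -/

/-- The shift with a given finite address. -/
def shift (S : SimSystem) (i : ℕ → Fin S.N) (J : ℕ) : ℂ :=
  ∑ j ∈ Finset.range J, (S.L : ℂ) ^ (j + 1) * S.ν (i j)

theorem shift_succ (i : ℕ → Fin S.N) (J : ℕ) :
    S.shift i (J + 1) = S.shift i J + (S.L : ℂ) ^ (J + 1) * S.ν (i J) :=
  Finset.sum_range_succ _ _

theorem pow_mul_Ψ (J : ℕ) (i : Fin S.N) (q : ℂ) :
    (S.L : ℂ) ^ (J + 1) * S.Ψ i q = (S.L : ℂ) ^ J * q + (S.L : ℂ) ^ (J + 1) * S.ν i := by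
  have := S.L_ne
  simp only [Ψ, pow_succ]; field_simp

theorem exists_add_shift_eq {x : ℂ} (hx : x ∈ S.fractal) (i : ℕ → Fin S.N) (J : ℕ) :
    ∃ q ∈ S.fractal, x + S.shift i J = (S.L : ℂ) ^ J * q := by
  induction J with
  | zero => exact ⟨x, hx, by simp [shift]⟩
  | succ J ih =>
    obtain ⟨q, hq, h⟩ := ih
    exact ⟨_, Ψ_mem hq (i J), by rw [shift_succ, ← add_assoc, h, pow_mul_Ψ]⟩

/-- A vertex of a large complex lies in only one subcell at each level, so its whole address
consists of maps fixing it. -/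
theorem corner_address (hS : S.IsSimpleNestedFractal) (hk : 3 ≤ S.k) (heven : Even S.k) {x v : ℂ}
    (hx : x ∈ S.fractal) (hv : v ∈ S.essentialPts) (i : ℕ → Fin S.N) (J : ℕ)
    (h : x + S.shift i J = (S.L : ℂ) ^ J * v) : x = v ∧ ∀ j < J, S.Ψ (i j) v = v := by
  induction J with
  | zero => exact ⟨by simpa [shift] using h, by simp⟩
  | succ J ih =>
    obtain ⟨q, hq, hxq⟩ := exists_add_shift_eq hx i J
    have h1 : S.Ψ (i J) q = v := by
      apply mul_left_cancel₀ (pow_ne_zero (J + 1) S.L_ne)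
      rw [← h, pow_mul_Ψ, shift_succ, ← add_assoc, hxq]
    have hqv := eq_of_Ψ_mem_essentialPts hS hk heven hv hq h1
    subst hqv
    obtain ⟨h2, h3⟩ := ih hxq
    refine ⟨h2, fun j hj => ?_⟩
    rcases Nat.lt_succ_iff_lt_or_eq.1 hj with hj | rfl
    · exact h3 j hj
    · exact h1

/-- Complexes with different addresses that meet do so at opposite vertices; below the last
position where the addresses differ they are the addresses of corners. -/
theorem address_of_add_shift_eq (hS : S.IsSimpleNestedFractal) (hk : 3 ≤ S.k) (heven : Even S.k)
    {x y : ℂ} (hx : x ∈ S.fractal) (hy : y ∈ S.fractal) (i l : ℕ → Fin S.N) (J : ℕ)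
    (h : x + S.shift i J = y + S.shift l J) (hne : ∃ j < J, i j ≠ l j) :
    x ∈ S.essentialPts ∧ y ∈ S.essentialPts ∧ x + y = 2 * S.barycenter 0 0 ∧
      ∃ m < J, i m ≠ l m ∧ S.Ψ (i m) x = S.Ψ (l m) y ∧ (∀ j < J, m < j → i j = l j) ∧
        ∀ j < m, S.Ψ (i j) x = x ∧ S.Ψ (l j) y = y := by
  induction J with
  | zero => obtain ⟨j, hj, -⟩ := hne; exact absurd hj (Nat.not_lt_zero j)
  | succ J ih =>
    by_cases hJ : i J = l J
    · rw [shift_succ, shift_succ, hJ, ← add_assoc, ← add_assoc] at h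
      obtain ⟨j, hj, hjne⟩ := hne
      obtain ⟨h1, h2, h3, m, hm, h4, h5, h6, h7⟩ := ih (add_right_cancel h) ⟨j,
        (Nat.lt_succ_iff_lt_or_eq.1 hj).resolve_right (fun e => hjne (e ▸ hJ)), hjne⟩
      refine ⟨h1, h2, h3, m, hm.trans (Nat.lt_succ_self J), h4, h5, fun j hj hmj => ?_, h7⟩
      rcases Nat.lt_succ_iff_lt_or_eq.1 hj with hj | rfl
      · exact h6 j hj hmj
      · exact hJ
    · obtain ⟨q, hq, hxq⟩ := exists_add_shift_eq hx i J
      obtain ⟨q', hq', hyq⟩ := exists_add_shift_eq hy l J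
      have h1 : S.Ψ (i J) q = S.Ψ (l J) q' := by
        apply mul_left_cancel₀ (pow_ne_zero (J + 1) S.L_ne)
        rw [pow_mul_Ψ, pow_mul_Ψ, ← hxq, ← hyq, add_assoc, add_assoc, ← shift_succ, ← shift_succ, h]
      obtain ⟨hqV, hqV'⟩ := mem_of_Ψ_eq hS hJ hq hq' h1
      obtain ⟨rfl, h2⟩ := corner_address hS hk heven hx hqV i J hxq
      obtain ⟨rfl, h3⟩ := corner_address hS hk heven hy hqV' l J hyq
      exact ⟨hqV, hqV', add_eq_of_Ψ_eq hS hk heven hJ hqV hqV' h1, J, Nat.lt_succ_self J, hJ, h1,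
        fun j hj hJj => by omega, fun j hj => ⟨h2 j hj, h3 j hj⟩⟩

/-- Padding with the digit whose translation is zero lets addresses of different lengths be
compared. -/
theorem exists_padded (o : Fin S.N) (i : ℕ → Fin S.N) (J : ℕ) :
    ∃ l : ℕ → Fin S.N, S.shift l J = S.shift i J ∧ ∀ j, J ≤ j → l j = o :=
  ⟨fun j => if j < J then i j else o,
    Finset.sum_congr rfl fun j hj => by simp only [if_pos (Finset.mem_range.1 hj)],
    fun j hj => if_neg hj.not_gt⟩

theorem shift_of_le {o : Fin S.N} (ho : S.ν o = 0) {i : ℕ → Fin S.N} {J J' : ℕ}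
    (hi : ∀ j, J ≤ j → i j = o) (h : J ≤ J') : S.shift i J' = S.shift i J := by
  induction J', h using Nat.le_induction with
  | base => rfl
  | succ n hn ih => rw [shift_succ, ih, hi n hn, ho, mul_zero, add_zero]

theorem sum_Icc_eq_shift (M : ℤ) (i : ℤ → Fin S.N) (n : ℕ) :
    ∑ j ∈ Finset.Icc (M + 1) (M + n), (S.L : ℂ) ^ j * S.ν (i j) =
      (S.L : ℂ) ^ M * S.shift (fun m => i (M + 1 + m)) n := by
  rw [shift, Finset.mul_sum]
  symm
  refine Finset.sum_nbij' (fun m : ℕ => M + 1 + (m : ℤ)) (fun j => (j - M - 1).toNat) ?_ ?_ ?_ ?_ ?_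
  · intro m hm
    simp only [Finset.mem_range, Finset.mem_Icc] at hm ⊢
    omega
  · intro m hm
    simp only [Finset.mem_range, Finset.mem_Icc] at hm ⊢
    omega
  · intro m hm
    omega
  · intro m hm
    simp only [Finset.mem_Icc] at hm
    omega
  · intro m hm
    rw [← mul_assoc, ← zpow_natCast, ← zpow_add₀ S.L_ne]
    congr 2
    push_cast
    ring

theorem scaled_mono {o : Fin S.N} (ho : S.ν o = 0) {M M' : ℤ} (h : M ≤ M') :
    S.scaled M ⊆ S.scaled M' := by
  induction M', h using Int.leInduction with
  | base => exact subset_rfl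
  | succ n hn ih =>
    refine ih.trans ?_
    rintro _ ⟨x, hx, rfl⟩
    refine ⟨_, Ψ_mem hx o, ?_⟩
    have := S.L_ne
    simp only [Ψ, ho, add_zero]
    rw [zpow_add_one₀ this]
    field_simp

/-- Inclusion in the unbounded fractal is automatic, because the scaled fractals increase when some
translation is zero. -/
theorem mem_complexShifts_iff {o : Fin S.N} (ho : S.ν o = 0) {M : ℤ} {c : ℂ} :
    c ∈ S.complexShifts M ↔ ∃ i J, c = (S.L : ℂ) ^ M * S.shift i J := by
  constructor
  · rintro ⟨⟨J, hJ, i, rfl⟩, -⟩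
    obtain ⟨n, rfl⟩ : ∃ n : ℕ, J = M + n := ⟨(J - M).toNat, by omega⟩
    exact ⟨_, n, sum_Icc_eq_shift M i n⟩
  · rintro ⟨i, J, rfl⟩
    obtain ⟨l, hl, hlo⟩ := exists_padded o i J
    constructor
    -- One padding digit is added because the definition of a shift excludes the empty sum.
    · refine ⟨M + (J + 1 : ℕ), by push_cast; omega, fun j => l (j - M - 1).toNat, ?_⟩
      rw [sum_Icc_eq_shift, ← hl, ← shift_of_le ho hlo (Nat.le_succ J)]
      congr 2
      funext m
      congr 1
      omega
    · rintro _ ⟨_, ⟨x, hx, rfl⟩, rfl⟩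
      obtain ⟨q, hq, h⟩ := exists_add_shift_eq hx i J
      refine Set.mem_iUnion.2 ⟨(M + J).toNat, scaled_mono ho (Int.self_le_toNat _) ⟨q, hq, ?_⟩⟩
      simp only
      rw [← mul_add, h, ← mul_assoc, ← zpow_natCast, ← zpow_add₀ S.L_ne]

theorem mem_complexShifts_zero_iff {o : Fin S.N} (ho : S.ν o = 0) {c : ℂ} :
    c ∈ S.complexShifts 0 ↔ ∃ i J, c = S.shift i J ∧ ∀ j, J ≤ j → i j = o := by
  rw [mem_complexShifts_iff ho]
  simp only [zpow_zero, one_mul]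
  constructor
  · rintro ⟨i, J, rfl⟩
    obtain ⟨l, hl, hlo⟩ := exists_padded o i J
    exact ⟨l, J, hl.symm, hlo⟩
  · rintro ⟨i, J, h, -⟩
    exact ⟨i, J, h⟩

theorem mem_levelVertices_iff {m : ℕ} {v : ℂ} :
    v ∈ S.levelVertices m ↔ ∃ x ∈ S.essentialPts, ∃ i, v = x + S.shift i m := by
  induction m generalizing v with
  | zero =>
    have : Nonempty (Fin S.N) := ⟨⟨0, S.N_pos⟩⟩
    simp [levelVertices, shift]
  | succ m ih =>
    simp only [levelVertices, Set.mem_iUnion, Set.mem_image]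
    constructor
    · rintro ⟨a, w, hw, rfl⟩
      obtain ⟨x, hx, i, rfl⟩ := ih.1 hw
      refine ⟨x, hx, Function.update i m a, ?_⟩
      rw [shift_succ, Function.update_self, add_assoc]
      congr 2
      exact Finset.sum_congr rfl fun j hj => by
        rw [Function.update_of_ne (Finset.mem_range.1 hj).ne]
    · rintro ⟨x, hx, i, rfl⟩
      exact ⟨i m, _, ih.2 ⟨x, hx, i, rfl⟩, by rw [shift_succ, add_assoc]⟩

theorem mem_unboundedVertices {M : ℤ} {x : ℂ} (hx : x ∈ S.essentialPts) (i : ℕ → Fin S.N) (J : ℕ) :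
    (S.L : ℂ) ^ M * (x + S.shift i J) ∈ S.unboundedVertices M :=
  ⟨_, Set.mem_iUnion.2 ⟨J, mem_levelVertices_iff.2 ⟨x, hx, i, rfl⟩⟩, rfl⟩

theorem essentialPts_mem_unboundedVertices {M : ℤ} {x : ℂ} (hx : x ∈ S.essentialPts) :
    (S.L : ℂ) ^ M * x ∈ S.unboundedVertices M := by
  have := mem_unboundedVertices (M := M) hx (fun _ => ⟨0, S.N_pos⟩) 0
  rwa [shift, Finset.sum_range_zero, add_zero] at this

/-- Different complexes that meet do so at opposite vertices. -/
theorem vertices_of_add_eq (hS : S.IsSimpleNestedFractal) {o : Fin S.N} (ho : S.ν o = 0)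
    (hk : 3 ≤ S.k) (heven : Even S.k) {c d x y : ℂ} (hc : c ∈ S.complexShifts 0)
    (hd : d ∈ S.complexShifts 0) (hcd : c ≠ d) (hx : x ∈ S.fractal) (hy : y ∈ S.fractal)
    (h : x + c = y + d) :
    x ∈ S.essentialPts ∧ y ∈ S.essentialPts ∧ x + y = 2 * S.barycenter 0 0 := by
  obtain ⟨i, J, rfl, hi⟩ := (mem_complexShifts_zero_iff ho).1 hc
  obtain ⟨l, J', rfl, hl⟩ := (mem_complexShifts_zero_iff ho).1 hd
  rw [← shift_of_le ho hi (le_max_left J J'), ← shift_of_le ho hl (le_max_right J J')] at hcd h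
  have hne : ∃ j < max J J', i j ≠ l j := by
    by_contra! hcon
    exact hcd (Finset.sum_congr rfl fun j hj => by rw [hcon j (Finset.mem_range.1 hj)])
  obtain ⟨h1, h2, h3, -⟩ := address_of_add_shift_eq hS hk heven hx hy i l _ h hne
  exact ⟨h1, h2, h3⟩

/-! ### From a good labelling to even closed paths. -/

/-- The rotation that a good labelling assigns to a complex, transported to order `0`. -/
theorem IsGoodLabelling.exists_root {o : Fin S.N} (ho : S.ν o = 0) (hk : S.k ≠ 0) {M : ℤ}
    {ℓ : S.unboundedVertices M → Fin S.k} (hℓ : S.IsGoodLabelling M ℓ) {c : ℂ}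
    (hc : c ∈ S.complexShifts 0) :
    ∃ z : ℂ, z ^ S.k = 1 ∧ ∀ v : S.unboundedVertices M, ∀ x ∈ S.essentialPts,
      (v : ℂ) = (S.L : ℂ) ^ M * (x + c) → ∃ w : S.unboundedVertices M,
        (w : ℂ) = (S.L : ℂ) ^ M * (S.barycenter 0 0 + z * (x - S.barycenter 0 0)) ∧ ℓ v = ℓ w := by
  obtain ⟨i, J, rfl, -⟩ := (mem_complexShifts_zero_iff ho).1 hc
  obtain ⟨j, -, hj⟩ := hℓ.rotation _ ((mem_complexShifts_iff ho).2 ⟨i, J, rfl⟩)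
  refine ⟨Complex.exp (2 * Real.pi * Complex.I * j / S.k), ?_, fun v x hx hv => ?_⟩
  · have hk' : (S.k : ℂ) ≠ 0 := by exact_mod_cast hk
    rw [← Complex.exp_nat_mul, mul_div_cancel₀ _ hk', mul_comm]
    exact Complex.exp_nat_mul_two_pi_mul_I j
  · obtain ⟨w, hw, hvw⟩ := hj v ⟨x, hx, by rw [hv, mul_add]⟩
    refine ⟨w, ?_, hvw⟩
    rw [hw, rot, hv, barycenter_eq M 0 hk]
    ring

theorem even_length_of_hasGLP (hS : S.IsSimpleNestedFractal) {o : Fin S.N} (ho : S.ν o = 0)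
    (hk : 3 ≤ S.k) (heven : Even S.k) (hglp : S.HasGLP) (p : S.centers)
    (w : S.centerGraph.Walk p p) : Even w.length := by
  obtain ⟨M, ℓ, hℓ⟩ := hglp
  have hk0 : S.k ≠ 0 := by omega
  set b := S.barycenter 0 0 with hb
  have hbar : ∀ c, S.barycenter 0 c = b + c := fun c => by
    rw [barycenter_eq 0 c hk0, zpow_zero, one_mul]
  have hmem : ∀ p : S.centers, (p : ℂ) - b ∈ S.complexShifts 0 := by
    rintro ⟨_, c, hc, rfl⟩
    simpa only [hbar, add_sub_cancel_left] using hc.1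
  choose r hr1 hr using fun p : S.centers => hℓ.exists_root ho hk0 (hmem p)
  have hadj : ∀ p q, S.centerGraph.Adj p q → r q = -r p := by
    rintro p q ⟨hpq, c, hc, d, hd, hp, hq, hne, t, ⟨_, ⟨x, hx, rfl⟩, rfl⟩, _, ⟨y, hy, rfl⟩, hxy⟩
    simp only [zpow_zero, one_mul] at hxy
    have hcd : c ≠ d := fun h => hne (by rw [h])
    obtain ⟨hxV, hyV, hsum⟩ := vertices_of_add_eq hS ho hk heven hc.1 hd.1 hcd hx hy hxy.symm
    have hpc : (p : ℂ) - b = c := by rw [hp, hbar, add_sub_cancel_left]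
    have hqd : (q : ℂ) - b = d := by rw [hq, hbar, add_sub_cancel_left]
    have hv : (S.L : ℂ) ^ M * (x + c) ∈ S.unboundedVertices M := by
      obtain ⟨i, J, rfl, -⟩ := (mem_complexShifts_zero_iff ho).1 hc.1
      exact mem_unboundedVertices hxV i J
    obtain ⟨w, hw, hvw⟩ := hr p ⟨_, hv⟩ x hxV (by rw [hpc])
    obtain ⟨w', hw', hvw'⟩ := hr q ⟨_, hv⟩ y hyV (by rw [hqd, hxy])
    -- Both rotated copies of the shared vertex are vertices of the base complex and carry the same
    -- label, so they coincide.
    have hinj := hℓ.bijOn.injOn (x₁ := w) (x₂ := w')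
      ⟨_, rotation_mem hS hk heven (hr1 p) hxV, by simp only [add_zero, hw, ← hb]⟩
      ⟨_, rotation_mem hS hk heven (hr1 q) hyV, by simp only [add_zero, hw', ← hb]⟩
      (hvw.symm.trans hvw')
    rw [hinj, hw'] at hw
    have h1 := add_left_cancel (mul_left_cancel₀ (zpow_ne_zero M S.L_ne) hw)
    have h2 : x - b ≠ 0 := sub_ne_zero.2 ((centre_spec hS hk heven).1 x hxV)
    apply mul_right_cancel₀ h2
    linear_combination -h1 + r q * hsum
  have hwalk : ∀ p q (w : S.centerGraph.Walk p q), r q = (-1) ^ w.length * r p := by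
    intro p q w
    induction w with
    | nil => simp
    | cons h _ ih => rw [ih, hadj _ _ h, SimpleGraph.Walk.length_cons, pow_succ]; ring
  have hr0 : r p ≠ 0 := by
    intro h
    have := hr1 p
    rw [h, zero_pow hk0] at this
    exact zero_ne_one this
  have h1 := mul_right_cancel₀ hr0 ((one_mul _).trans (hwalk p p w))
  exact (neg_one_pow_eq_one_iff_even (by norm_num)).1 h1.symm

/-! ### From a bipartition to a coloring of all complexes. -/

/-- A function on the cells that agrees on cells with a common vertex is constant. -/
theorem eq_of_forall_adjacent (hS : S.IsSimpleNestedFractal) {α : Type*} (f : Fin S.N → α)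
    (hf : ∀ i j, i ≠ j → ∀ x ∈ S.essentialPts, ∀ y ∈ S.essentialPts, S.Ψ i x = S.Ψ j y → f i = f j)
    (i j : Fin S.N) : f i = f j := by
  have hV : S.essentialPts.Nonempty := by
    apply Set.nonempty_of_ncard_ne_zero
    have := hS.two_le_k
    unfold k at this
    omega
  obtain ⟨v, hv⟩ := hV
  have hf' : ∀ i j, ∀ p, p ∈ S.Ψ i '' S.essentialPts → p ∈ S.Ψ j '' S.essentialPts → f i = f j := by
    rintro i j _ ⟨x, hx, rfl⟩ ⟨y, hy, h⟩
    by_cases hij : i = j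
    · rw [hij]
    · exact hf i j hij x hx y hy h.symm
  -- The graph joins points through whole cells; nesting shows that its points are met by a cell
  -- only at that cell's own vertices.
  have hin : ∀ i (p : (⋃ i, S.Ψ i '' S.essentialPts : Set ℂ)), (p : ℂ) ∈ S.Ψ i '' S.fractal →
      (p : ℂ) ∈ S.Ψ i '' S.essentialPts := by
    rintro i ⟨p, hp⟩ ⟨x, hx, hxp⟩
    obtain ⟨j, y, hy, hyp⟩ := Set.mem_iUnion.1 hp
    by_cases hij : i = j
    · exact ⟨y, hy, hij ▸ hyp⟩
    · exact ⟨x, (mem_of_Ψ_eq hS hij hx (essentialPts_subset hy) (hxp.trans hyp.symm)).1, hxp⟩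
  have hwalk : ∀ p q, S.cellPointGraph.Walk p q → ∀ i j, (p : ℂ) ∈ S.Ψ i '' S.essentialPts →
      (q : ℂ) ∈ S.Ψ j '' S.essentialPts → f i = f j := by
    intro p q w
    induction w with
    | nil => exact fun i j hi hj => hf' i j _ hi hj
    | cons h _ ih =>
      obtain ⟨-, a, ha, ha'⟩ := h
      exact fun i j hi hj => (hf' i a _ hi (hin a _ ha)).trans (ih a j (hin a _ ha') hj)
  have hvi : ∀ i, S.Ψ i v ∈ ⋃ i, S.Ψ i '' S.essentialPts := fun i =>
    Set.mem_iUnion.2 ⟨i, v, hv, rfl⟩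
  obtain ⟨w⟩ := hS.connectivity.preconnected ⟨_, hvi i⟩ ⟨_, hvi j⟩
  exact hwalk _ _ w i j ⟨v, hv, rfl⟩ ⟨v, hv, rfl⟩

/-- The colorings of the cells by `ZMod 2` that change between cells with a common vertex. -/
def IsCellColoring (S : SimSystem) (χ : Fin S.N → ZMod 2) : Prop :=
  ∀ i j, i ≠ j → ∀ x ∈ S.essentialPts, ∀ y ∈ S.essentialPts, S.Ψ i x = S.Ψ j y → χ i = χ j + 1

theorem mem_innerShifts {o : Fin S.N} (ho : S.ν o = 0) (i : Fin S.N) :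
    (S.L : ℂ) * S.ν i ∈ S.innerShifts := by
  refine ⟨(mem_complexShifts_iff ho).2 ⟨fun _ => i, 1, by simp [shift]⟩, ?_⟩
  rintro _ ⟨_, ⟨x, hx, rfl⟩, rfl⟩
  refine ⟨_, Ψ_mem hx i, ?_⟩
  have := S.L_ne
  simp only [Ψ, zpow_one, zpow_zero]
  field_simp

/-- If distinct shifts gave the same set, every vertex `x` would satisfy the same equation for `2 *
x`, although there are at least two vertices. -/
theorem cell_injective (hS : S.IsSimpleNestedFractal) {o : Fin S.N} (ho : S.ν o = 0)
    (hk : 3 ≤ S.k) (heven : Even S.k) {c d : ℂ} (hc : c ∈ S.complexShifts 0)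
    (hd : d ∈ S.complexShifts 0) (h : S.cell 0 c = S.cell 0 d) : c = d := by
  by_contra hcd
  obtain ⟨v, w, hv, hw, hvw⟩ := (Set.one_lt_ncard_iff finite_essentialPts).1
    (show 1 < S.k by omega)
  have key : ∀ x ∈ S.essentialPts, 2 * x = 2 * S.barycenter 0 0 + d - c := by
    intro x hx
    have hxc : x + c ∈ S.cell 0 c := ⟨x, ⟨x, essentialPts_subset hx, by simp⟩, rfl⟩
    rw [h] at hxc
    obtain ⟨_, ⟨y, hy, rfl⟩, hyx⟩ := hxc
    simp only [zpow_zero, one_mul] at hyx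
    obtain ⟨-, -, hsum⟩ :=
      vertices_of_add_eq hS ho hk heven hc hd hcd (essentialPts_subset hx) hy hyx.symm
    linear_combination hsum - hyx
  exact hvw (mul_left_cancel₀ two_ne_zero ((key v hv).trans (key w hw).symm))

theorem exists_cellColoring (hS : S.IsSimpleNestedFractal) {o : Fin S.N} (ho : S.ν o = 0)
    (hk : 3 ≤ S.k) (heven : Even S.k) (hG : S.centerGraph.IsBipartite) :
    ∃ χ, S.IsCellColoring χ ∧ χ o = 0 := by
  obtain ⟨C⟩ := hG
  have hbar : ∀ c, S.barycenter 0 c = S.barycenter 0 0 + c := fun c => by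
    rw [barycenter_eq 0 c (by omega), zpow_zero, one_mul]
  let χ : Fin S.N → ZMod 2 := fun i => C ⟨_, _, mem_innerShifts ho i, rfl⟩
  have hz : ∀ a b : ZMod 2, a ≠ b → a = b + 1 := by decide
  -- Subtracting `χ o` makes the padding digit colorless.
  refine ⟨fun i => χ i - χ o, fun i j hij x hx y hy hxy => ?_, sub_self _⟩
  have hadj : S.centerGraph.Adj ⟨_, _, mem_innerShifts ho i, rfl⟩
      ⟨_, _, mem_innerShifts ho j, rfl⟩ := by
    have hne : (S.L : ℂ) * S.ν i ≠ S.L * S.ν j := fun h =>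
      hij (hS.ν_injective (mul_left_cancel₀ S.L_ne h))
    refine ⟨fun h => hne ?_, _, mem_innerShifts ho i, _, mem_innerShifts ho j, rfl, rfl, ?_, ?_⟩
    · have := congrArg Subtype.val h
      simp only at this
      rw [hbar, hbar (S.L * S.ν j)] at this
      exact add_left_cancel this
    · exact fun h => hne (cell_injective hS ho hk heven (mem_innerShifts ho i).1
        (mem_innerShifts ho j).1 h)
    · refine ⟨S.L * S.Ψ i x, ⟨_, ⟨x, essentialPts_subset hx, rfl⟩, ?_⟩,
        ⟨_, ⟨y, essentialPts_subset hy, rfl⟩, ?_⟩⟩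
      · have := S.L_ne
        simp only [Ψ, zpow_zero]
        field_simp
      · have := S.L_ne
        rw [hxy]
        simp only [Ψ, zpow_zero]
        field_simp
  have : χ i = χ j + 1 := hz _ _ (C.valid hadj)
  simp only [this]
  ring

/-- The central symmetry changes a coloring of the cells by a constant. -/
theorem IsCellColoring.exists_antipode (hS : S.IsSimpleNestedFractal) (hk : 3 ≤ S.k)
    (heven : Even S.k) {χ : Fin S.N → ZMod 2} (hχ : S.IsCellColoring χ) :
    ∃ t, ∀ i j v, S.Ψ i v = v →
      S.Ψ j (2 * S.barycenter 0 0 - v) = 2 * S.barycenter 0 0 - v → χ j = χ i + t := by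
  choose σ hσ using (centre_spec hS hk heven).2.2
  -- The half-turn preserves adjacency, so `χ` and `χ ∘ σ` flip together and their difference is
  -- constant.
  have hconst := eq_of_forall_adjacent hS (fun i => χ (σ i) - χ i) fun i j hij x hx y hy hxy => by
    have hne : σ i ≠ σ j := by
      intro h
      apply hij
      apply hS.ν_injective
      have h1 := hσ i x
      have h2 := hσ j x
      rw [h, h2] at h1
      simpa only [Ψ, sub_right_inj, add_right_inj, eq_comm] using h1
    have h1 := hχ i j hij x hx y hy hxy
    have h2 := hχ (σ i) (σ j) hne _ (antipode_mem hS hk heven hx) _ (antipode_mem hS hk heven hy)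
      (by rw [hσ, hσ, hxy])
    rw [h1, h2]
    ring
  refine ⟨χ (σ ⟨0, S.N_pos⟩) - χ ⟨0, S.N_pos⟩, fun i j v hi hj => ?_⟩
  have hj' : j = σ i := by
    apply hS.ν_injective
    have := hj.trans ((hσ i v).trans (by rw [hi])).symm
    simpa only [Ψ, add_right_inj] using this
  rw [← hconst i ⟨0, S.N_pos⟩, hj']
  ring

/-- The color of a complex of order `0` in terms of its address. -/
def color (χ : Fin S.N → ZMod 2) (θ : ZMod 2) (i : ℕ → Fin S.N) (J : ℕ) : ZMod 2 :=
  χ (i 0) + ∑ j ∈ Finset.range J, θ * χ (i (j + 1))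

/-- The color reads the digits from `0` to `J`, one more than the shift does; the padding digits it
meets contribute nothing. -/
theorem color_of_le {χ : Fin S.N → ZMod 2} (θ : ZMod 2) {o : Fin S.N} (ho : χ o = 0)
    {i : ℕ → Fin S.N} {J J' : ℕ} (hi : ∀ j, J ≤ j → i j = o) (h : J ≤ J') :
    color χ θ i J' = color χ θ i J := by
  induction J', h using Nat.le_induction with
  | base => rfl
  | succ n hn ih =>
    rw [← ih, color, color, Finset.sum_range_succ, hi (n + 1) (by omega), ho, mul_zero, add_zero]

/-- Let `m` be the last place where the addresses differ. There `χ` changes by `1`; below it the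
digits are those of opposite corners, so `χ` changes by `t`. For `m = 0` the color changes by `1`.
For `m > 0` the change is `t + (1 + t)`, again `1`, since the intermediate digits contribute `(1 +
t) * t = 0`. -/
theorem color_eq_add_one (hS : S.IsSimpleNestedFractal) (hk : 3 ≤ S.k) (heven : Even S.k)
    {χ : Fin S.N → ZMod 2} (hχ : S.IsCellColoring χ) {t : ZMod 2}
    (ht : ∀ i j v, S.Ψ i v = v →
      S.Ψ j (2 * S.barycenter 0 0 - v) = 2 * S.barycenter 0 0 - v → χ j = χ i + t)
    {x y : ℂ} (hx : x ∈ S.fractal) (hy : y ∈ S.fractal) {i l : ℕ → Fin S.N} {J : ℕ}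
    (h : x + S.shift i J = y + S.shift l J) (hne : ∃ j < J, i j ≠ l j)
    (hJ : ∀ j, J ≤ j → i j = l j) :
    x + y = 2 * S.barycenter 0 0 ∧ color χ (1 + t) l J = color χ (1 + t) i J + 1 := by
  obtain ⟨hxV, hyV, hsum, m, hmJ, hm, hΨ, hgt, hlt⟩ :=
    address_of_add_shift_eq hS hk heven hx hy i l J h hne
  have hy' : y = 2 * S.barycenter 0 0 - x := by linear_combination hsum
  refine ⟨hsum, ?_⟩
  have hgt' : ∀ j, m < j → i j = l j := fun j hj => by
    by_cases hjJ : j < J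
    · exact hgt j hjJ hj
    · exact hJ j (not_lt.1 hjJ)
  have hlt' : ∀ j, j < m → χ (l j) = χ (i j) + t := fun j hj =>
    ht _ _ x (hlt j hj).1 (by rw [← hy']; exact (hlt j hj).2)
  have hm' : χ (l m) = χ (i m) + 1 := hχ _ _ hm.symm y hyV x hxV hΨ.symm
  have hθ : ∀ t : ZMod 2, (1 + t) * t = 0 := by decide
  have ht2 : ∀ t : ZMod 2, t + (1 + t) = 1 := by decide
  have hterm : ∀ j, (1 + t) * χ (l (j + 1)) =
      (1 + t) * χ (i (j + 1)) + if j + 1 = m then 1 + t else 0 := by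
    intro j
    rcases lt_trichotomy (j + 1) m with hj | hj | hj
    · rw [if_neg hj.ne, hlt' _ hj, mul_add, hθ]
    · rw [if_pos hj, hj, hm', mul_add, mul_one]
    · rw [if_neg hj.ne', hgt' _ hj, add_zero]
  unfold color
  rw [Finset.sum_congr rfl fun j _ => hterm j, Finset.sum_add_distrib]
  rcases Nat.eq_zero_or_pos m with rfl | hpos
  · rw [hm', Finset.sum_eq_zero fun j _ => if_neg (Nat.succ_ne_zero j)]
    ring
  · have h1 : ∑ j ∈ Finset.range J, (if j + 1 = m then 1 + t else 0) = 1 + t := by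
      rw [Finset.sum_eq_single (m - 1)]
      · rw [if_pos (by omega)]
      · exact fun j _ hj => if_neg (by omega)
      · exact fun hj => absurd (Finset.mem_range.2 (by omega)) hj
    rw [h1, hlt' 0 hpos]
    linear_combination ht2 t

/-! ### The labelling built from the coloring. -/

/-- `u` is the label of the vertex `v` for the labelling that turns the complexes of color `1`. -/
def IsLabel (χ : Fin S.N → ZMod 2) (θ : ZMod 2) (o : Fin S.N) (v u : ℂ) : Prop :=
  ∃ x ∈ S.essentialPts, ∃ i J, (∀ j, J ≤ j → i j = o) ∧ v = x + S.shift i J ∧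
    u = if color χ θ i J = 0 then x else 2 * S.barycenter 0 0 - x

theorem IsLabel.unique (hS : S.IsSimpleNestedFractal) (hk : 3 ≤ S.k) (heven : Even S.k)
    {o : Fin S.N} (ho : S.ν o = 0) {χ : Fin S.N → ZMod 2} (hχ : S.IsCellColoring χ) (hχo : χ o = 0)
    {t : ZMod 2} (ht : ∀ i j v, S.Ψ i v = v →
      S.Ψ j (2 * S.barycenter 0 0 - v) = 2 * S.barycenter 0 0 - v → χ j = χ i + t) {v u w : ℂ}
    (hu : IsLabel χ (1 + t) o v u) (hw : IsLabel χ (1 + t) o v w) : u = w := by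
  obtain ⟨x, hx, i, J, hi, rfl, rfl⟩ := hu
  obtain ⟨y, hy, l, J', hl, h, rfl⟩ := hw
  have hJ := le_max_left J J'
  have hJ' := le_max_right J J'
  rw [← shift_of_le ho hi hJ, ← shift_of_le ho hl hJ'] at h
  rw [← color_of_le _ hχo hi hJ, ← color_of_le _ hχo hl hJ']
  have hge : ∀ j, max J J' ≤ j → i j = l j := fun j hj =>
    (hi j (hJ.trans hj)).trans (hl j (hJ'.trans hj)).symm
  by_cases hne : ∃ j < max J J', i j ≠ l j
  · obtain ⟨h1, h2⟩ := color_eq_add_one hS hk heven hχ ht (essentialPts_subset hx)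
      (essentialPts_subset hy) h hne hge
    -- Exactly one of the two complexes is turned, and turning one of two opposite vertices gives
    -- the other.
    have hz : ∀ a : ZMod 2, (a = 0 ∧ a + 1 ≠ 0) ∨ (a ≠ 0 ∧ a + 1 = 0) := by decide
    rw [h2]
    rcases hz (color χ (1 + t) i (max J J')) with ⟨h3, h4⟩ | ⟨h3, h4⟩
    · rw [if_pos h3, if_neg h4]; linear_combination h1
    · rw [if_neg h3, if_pos h4]; linear_combination -h1
  · push Not at hne
    have hil : i = l := funext fun j => (lt_or_ge j (max J J')).elim (hne j) (hge j)
    subst hil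
    rw [add_right_cancel h]

theorem hasGLP_of_isBipartite (hS : S.IsSimpleNestedFractal) {o : Fin S.N} (ho : S.ν o = 0)
    (hk : 3 ≤ S.k) (heven : Even S.k) (hG : S.centerGraph.IsBipartite) : S.HasGLP := by
  obtain ⟨χ, hχ, hχo⟩ := exists_cellColoring hS ho hk heven hG
  obtain ⟨t, ht⟩ := hχ.exists_antipode hS hk heven
  have hk' : (S.k : ℂ) ≠ 0 := by exact_mod_cast (by omega : S.k ≠ 0)
  have hex : ∀ v : S.unboundedVertices 0, ∃ u : S.essentialPts, IsLabel χ (1 + t) o (v : ℂ) u := by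
    rintro ⟨_, w, hw, rfl⟩
    obtain ⟨J, hJ⟩ := Set.mem_iUnion.1 hw
    obtain ⟨x, hx, i, rfl⟩ := mem_levelVertices_iff.1 hJ
    obtain ⟨l, hl, hlo⟩ := exists_padded o i J
    refine ⟨⟨if color χ (1 + t) l J = 0 then x else 2 * S.barycenter 0 0 - x, ?_⟩,
      x, hx, l, J, hlo, by simp [hl], rfl⟩
    split_ifs
    · exact hx
    · exact antipode_mem hS hk heven hx
  choose lab hlab using hex
  have huniq : ∀ (v : S.unboundedVertices 0) (u : ℂ), IsLabel χ (1 + t) o (v : ℂ) u →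
      (lab v : ℂ) = u := fun v u hu => IsLabel.unique hS hk heven ho hχ hχo ht (hlab v) hu
  have hlabV : ∀ v : S.unboundedVertices 0, (v : ℂ) ∈ S.essentialPts → (lab v : ℂ) = v :=
    fun v hv => huniq v v ⟨v, hv, fun _ => o, 0, fun _ _ => rfl, by simp [shift],
      by simp [color, hχo]⟩
  have hV : S.cellVertices 0 0 = S.essentialPts := by simp [cellVertices]
  have hVmem : ∀ x ∈ S.essentialPts, x ∈ S.unboundedVertices 0 := fun x hx => by
    simpa using essentialPts_mem_unboundedVertices (M := 0) hx
  have : Finite S.essentialPts := finite_essentialPts.to_subtype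
  have e : S.essentialPts ≃ Fin S.k := Finite.equivFinOfCardEq rfl
  refine ⟨0, fun v => e (lab v), ⟨fun _ _ => Set.mem_univ _, ?_, ?_⟩, ?_⟩
  · intro v hv w hw hvw
    rw [hV] at hv hw
    have := e.injective hvw
    exact Subtype.ext (by rw [← hlabV v hv, ← hlabV w hw, this])
  · intro a _
    refine ⟨⟨_, hVmem _ (e.symm a).2⟩, ?_, ?_⟩
    · rw [hV]; exact (e.symm a).2
    · have : lab ⟨_, hVmem _ (e.symm a).2⟩ = e.symm a := Subtype.ext (hlabV _ (e.symm a).2)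
      simp only [this, Equiv.apply_symm_apply]
  · intro c hc
    obtain ⟨i, J, rfl, hi⟩ := (mem_complexShifts_zero_iff ho).1 hc
    have hlabel : ∀ v : S.unboundedVertices 0, ∀ x ∈ S.essentialPts, x + S.shift i J = v →
        (lab v : ℂ) = if color χ (1 + t) i J = 0 then x else 2 * S.barycenter 0 0 - x :=
      fun v x hx hv => huniq v _ ⟨x, hx, i, J, hi, hv.symm, rfl⟩
    by_cases hcol : color χ (1 + t) i J = 0
    -- The identity is the rotation with `j = k`, as `j = 0` is not allowed.
    · refine ⟨S.k, Finset.mem_Icc.2 ⟨by omega, le_rfl⟩, fun v hv => ?_⟩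
      obtain ⟨x, hx, hxv⟩ := hv
      simp only [zpow_zero, one_mul] at hxv
      refine ⟨⟨x, hVmem x hx⟩, ?_, ?_⟩
      · rw [rot, mul_div_cancel_right₀ _ hk', Complex.exp_two_pi_mul_I, ← hxv]
        ring
      · congr 1
        apply Subtype.ext
        rw [hlabel v x hx hxv, if_pos hcol, hlabV _ hx]
    -- The half-turn; the division is exact because `k` is even.
    · refine ⟨S.k / 2, Finset.mem_Icc.2 ⟨by omega, by omega⟩, fun v hv => ?_⟩
      obtain ⟨x, hx, hxv⟩ := hv
      simp only [zpow_zero, one_mul] at hxv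
      have hx' := antipode_mem hS hk heven hx
      refine ⟨⟨_, hVmem _ hx'⟩, ?_, ?_⟩
      · have harg : 2 * Real.pi * Complex.I * ((S.k / 2 : ℕ) : ℂ) / S.k = Real.pi * Complex.I := by
          rw [Nat.cast_div heven.two_dvd (by norm_num)]
          field_simp
          push_cast
          ring
        rw [rot, harg, Complex.exp_pi_mul_I, ← hxv]
        ring
      · congr 1
        apply Subtype.ext
        rw [hlabel v x hx hxv, if_neg hcol, hlabV _ hx']

end SimSystem

end NestedFractal

theorem mainTheorem7 (S : NestedFractal.SimSystem) (hS : S.IsSimpleNestedFractal)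
    (h0 : ∃ i, S.ν i = 0) (hk : 3 ≤ S.k) (heven : Even S.k) :
    (S.HasGLP ↔
      ∀ (p : S.centers) (w : S.centerGraph.Walk p p), Even w.length) ∧
    ((∀ (p : S.centers) (w : S.centerGraph.Walk p p), Even w.length) ↔
      S.centerGraph.IsBipartite) := by
  obtain ⟨o, ho⟩ := h0
  have h := SimpleGraph.two_colorable_iff_forall_loop_even (G := S.centerGraph)
  exact ⟨⟨S.even_length_of_hasGLP hS ho hk heven,
    fun he => S.hasGLP_of_isBipartite hS ho hk heven (h.2 he)⟩, h.symm⟩
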